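/- \textbf{Setting.} Let $E$ be a locally compact Hausdorff space with a countable base, with its Borel $\sigma$-algebra, and let $\Omega$ be the set of continuous maps $\omega:[0,\infty)\to E$, with the compact-open topology and the $\sigma$-algebra generated by the coordinate maps $X_t(\omega)=\omega(t)$ (which is its Borel $\sigma$-algebra). Let $(\hat P_t)_{t\ge 0}$ be an honest Feller--Dynkin semigroup on $C_0(E)$: a strongly continuous semigroup of bounded linear operators such that $0\le f\le 1$ implies $0\le \hat P_t f\le 1$, and whose representing kernels, given by $\hat P_tf(x)=\int f\,\mathrm{d}P_t(x)$ for $f \in C_0(E)$, are Markov kernels. Assume that it defines a diffusion: for each $x\in E$ there is a probability measure $\mathbb P^x$ on $\Omega$ with $$\mathbb P^x(X_0\in dx_0,X_{t_1}\in dx_1,\dots,X_{t_n}\in dx_n)=\delta_x(dx_0)P_{t_1}(x_0,dx_1)\cdots P_{t_n-t_{n-1}}(x_{n-1},dx_n)$$ for all $n \ge 0$ and $0<t_1<\dots<t_n$, and $x\mapsto\mathbb P^x$ is weakly continuous. Let $obs:E\to[0,1]$ be continuous and let $0<c<1$. \textbf{The functional.} For a lower semi-continuous pseudometric $m:E\times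 E\to[0,1]$ put $$U_c(m)(\omega,\omega')=\sup_{t\ge 0}c^t\,m(\omega(t),\omega'(t)),\qquad \mathcal G_c(m)(x,y)=\inf_{\gamma\in\Gamma(\mathbb P^x,\mathbb P^y)}\int U_c(m)\,\mathrm{d}\gamma ,$$ where $\Gamma(\mu,\nu)$ is the set of couplings of $\mu$ and $\nu$ (probability measures on $\Omega\times\Omega$ with marginals $\mu$ and $\nu$). \textbf{The logic.} State expressions $f\in\mathcal L_\sigma$ and trajectory expressions $g\in\mathcal L_\tau$ are defined by mutual induction: $$f ::= q\mid obs\mid 1-f\mid \textstyle\int g,\qquad g ::= f\circ ev_t\mid \min\{g_1,g_2\}\mid\max\{g_1,g_2\}\mid g\ominus q\mid g\oplus q,$$ with $q\in\mathbb Q\cap[0,1]$ and $t\in\mathbb Q_{\ge 0}$. They are interpreted as functions $E\to[0,1]$ and $\Omega\to[0,1]$ by $q(x)=q$, $obs(x)=obs(x)$, $(1-f)(x)=1-f(x)$, $(\int g)(x)=\int g\,\mathrm{d}\mathbb P^x$, $(f\circ ev_t)(\omega)=c^tf(\omega(t))$, pointwise $\min$ and $\max$, $(g\ominus q)(\omega)=\max\{0,g(\omega)-q\}$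 and $(g\oplus q)(\omega)=\min\{1,g(\omega)+q\}$. Define $$\ell^c(x,y)=\sup_{f\in\mathcal L_\sigma}|f(x)-f(y)|,\qquad x,y\in E.$$ \textbf{Theorem.} $\ell^c$ is a lower semi-continuous pseudometric on $E$ with values in $[0,1]$, and it is a fixpoint of $\mathcal G_c$: $\mathcal G_c(\ell^c)=\ell^c$. Moreover, for all $x,y\in E$ the infimum defining $\mathcal G_c(\ell^c)(x,y)$ is attained. -/

import Mathlib

open MeasureTheory ProbabilityTheory Filter Set
open scoped NNReal ENNReal Topology ZeroAtInfty unitInterval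

namespace DiffusionLogic

/-! ### Trajectories -/

/-- The trajectory space `Ω` of all continuous maps `[0, ∞) → E`, with the compact-open topology
(locally uniform convergence). -/
abbrev Trajectory (E : Type*) [TopologicalSpace E] := C(ℝ≥0, E)

/-- The `σ`-algebra `𝒜 = σ(X_s | s ≥ 0)` on `Ω` generated by the coordinate maps
`X_s ω = ω s`. -/
instance trajectoryMeasurableSpace (E : Type*) [TopologicalSpace E] [MeasurableSpace E] :
    MeasurableSpace (Trajectory E) :=
  ⨆ s : ℝ≥0, MeasurableSpace.comap (fun ω : Trajectory E => ω s) inferInstance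

theorem measurable_coord {E : Type*} [TopologicalSpace E] [MeasurableSpace E] (s : ℝ≥0) :
    Measurable (fun ω : Trajectory E => ω s) := by
  rw [measurable_iff_comap_le]
  exact le_iSup (fun s : ℝ≥0 =>
    MeasurableSpace.comap (fun ω : Trajectory E => ω s) inferInstance) s

/-- The `σ`-algebra generated by the coordinate maps is the Borel `σ`-algebra of `Ω`. -/
instance trajectoryBorelSpace (E : Type*) [TopologicalSpace E] [LocallyCompactSpace E]
    [T2Space E] [SecondCountableTopology E] [MeasurableSpace E] [BorelSpace E] :
    BorelSpace (Trajectory E) := by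
  constructor
  apply le_antisymm
  · refine iSup_le fun s => ?_
    rw [← measurable_iff_comap_le]
    have hc : Continuous (fun ω : Trajectory E => ω s) := continuous_eval_const s
    exact @Continuous.measurable _ _ _ (borel (Trajectory E))
      (@OpensMeasurableSpace.mk _ _ (borel (Trajectory E)) le_rfl) _ _ _ _ hc
  · have hsub := borel_eq_generateFrom_of_subbasis
      (ContinuousMap.compactOpen_eq (X := ℝ≥0) (Y := E))
    rw [hsub]
    refine MeasurableSpace.generateFrom_le ?_
    rintro _ ⟨K, hK, U, hU, rfl⟩
    let _ : MetricSpace E := TopologicalSpace.metrizableSpaceMetric E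
    obtain ⟨D, hDc, hDd⟩ := TopologicalSpace.exists_countable_dense K
    have key : {ω : Trajectory E | MapsTo ω K U} =
        ⋃ n : ℕ, ⋂ q ∈ D, (fun ω : Trajectory E => ω q.1) ⁻¹'
          {z | ((n : ℝ≥0∞))⁻¹ ≤ Metric.infEDist z Uᶜ} := by
      ext ω
      simp only [mem_ofPred_eq, mem_iUnion, mem_iInter, mem_preimage]
      constructor
      · intro h
        have hpos : ∀ t ∈ K, 0 < Metric.infEDist (ω t) Uᶜ := fun t ht => by
          rw [Metric.infEDist_pos_iff_notMem_closure, hU.isClosed_compl.closure_eq]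
          exact fun h' => h' (h ht)
        obtain ⟨n, hn⟩ : ∃ n : ℕ, ∀ t ∈ K, ((n : ℝ≥0∞))⁻¹ ≤ Metric.infEDist (ω t) Uᶜ := by
          rcases K.eq_empty_or_nonempty with rfl | hne
          · exact ⟨0, by simp⟩
          · obtain ⟨t₀, ht₀, hmin⟩ := IsCompact.exists_isMinOn hK hne
              (f := fun t => Metric.infEDist (ω t) Uᶜ)
              (Metric.continuous_infEDist.comp ω.continuous).continuousOn
            obtain ⟨n, hn⟩ := ENNReal.exists_inv_nat_lt (hpos t₀ ht₀).ne'
            exact ⟨n, fun t ht => hn.le.trans (hmin ht)⟩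
        exact ⟨n, fun q _ => hn q.1 q.2⟩
      · rintro ⟨n, hn⟩ t ht
        have hcl : IsClosed {q : K | ((n : ℝ≥0∞))⁻¹ ≤ Metric.infEDist (ω q.1) Uᶜ} :=
          isClosed_le continuous_const
            (Metric.continuous_infEDist.comp (ω.continuous.comp continuous_subtype_val))
        have hle := closure_minimal (fun q hq => hn q hq) hcl (hDd (⟨t, ht⟩ : K))
        by_contra hne
        have h0 : Metric.infEDist (ω t) Uᶜ = 0 :=
          Metric.infEDist_zero_of_mem hne
        have hle' : ((n : ℝ≥0∞))⁻¹ ≤ Metric.infEDist (ω t) Uᶜ := hle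
        rw [h0] at hle'
        simp at hle'
    change MeasurableSet {ω : Trajectory E | MapsTo ω K U}
    rw [key]
    refine MeasurableSet.iUnion fun n => MeasurableSet.biInter hDc fun q _ => ?_
    exact measurable_coord q.1 (isClosed_le continuous_const
      Metric.continuous_infEDist).measurableSet

/-! ### Feller-Dynkin semigroups and diffusions -/

/-- A Feller-Dynkin semigroup on `C₀(E)`: a strongly continuous semigroup of bounded operators
with `0 ≤ f ≤ 1 → 0 ≤ P̂ₜ f ≤ 1`. -/
structure FellerDynkinSemigroup (E : Type*) [TopologicalSpace E] where
  op : ℝ≥0 → C₀(E, ℝ) →L[ℝ] C₀(E, ℝ)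
  op_comp : ∀ s t : ℝ≥0, (op s).comp (op t) = op (s + t)
  op_zero : op 0 = ContinuousLinearMap.id ℝ C₀(E, ℝ)
  strongly_continuous : ∀ f : C₀(E, ℝ), Tendsto (fun t : ℝ≥0 => op t f) (𝓝[>] 0) (𝓝 f)
  sub_markov : ∀ (t : ℝ≥0) (f : C₀(E, ℝ)), (∀ x, 0 ≤ f x ∧ f x ≤ 1) →
    ∀ x, 0 ≤ op t f x ∧ op t f x ≤ 1

/-- For times `s < t₁ < ⋯ < tₙ` and sets `C₁, …, Cₙ`, the iterated integral
`∫_{C₁} P_{t₁-s}(x, dx₁) ∫_{C₂} P_{t₂-t₁}(x₁, dx₂) ⋯ ∫_{Cₙ} P_{tₙ-tₙ₋₁}(xₙ₋₁, dxₙ)`. -/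
noncomputable def cylinderMass {E : Type*} [MeasurableSpace E] (P : ℝ≥0 → Kernel E E) :
    ℝ≥0 → List (ℝ≥0 × Set E) → E → ℝ≥0∞
  | _, [], _ => 1
  | s, (t, C) :: l, x => ∫⁻ y in C, cylinderMass P t l y ∂(P (t - s) x)

/-- A diffusion on `E`: an honest Feller-Dynkin process with continuous trajectories whose laws
`ℙˣ` depend weakly continuously on the starting point `x`. -/
structure Diffusion (E : Type*) [TopologicalSpace E] [LocallyCompactSpace E] [T2Space E]
    [SecondCountableTopology E] [MeasurableSpace E] [BorelSpace E] where
  /-- the Feller-Dynkin semigroup `(P̂ₜ)` -/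
  semigroup : FellerDynkinSemigroup E
  /-- the transition kernels `(Pₜ)`, determined by the semigroup through `kernel_repr` -/
  kernel : ℝ≥0 → Kernel E E
  kernel_repr : ∀ (t : ℝ≥0) (f : C₀(E, ℝ)) (x : E),
    semigroup.op t f x = ∫ y, f y ∂(kernel t x)
  /-- the semigroup is honest: `Pₜ(x, E) = 1` -/
  honest : ∀ t : ℝ≥0, IsMarkovKernel (kernel t)
  /-- the laws `ℙˣ` on trajectory space, determined by `law_cylinder` -/
  law : E → ProbabilityMeasure (Trajectory E)
  /-- finite-dimensional distributions: for `0 < t₁ < ⋯ < tₙ`,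
  `ℙˣ(X₀ ∈ dx₀, X_{t₁} ∈ dx₁, …, X_{tₙ} ∈ dxₙ) = δₓ(dx₀) P_{t₁}(x₀, dx₁) ⋯
  P_{tₙ-tₙ₋₁}(xₙ₋₁, dxₙ)` -/
  law_cylinder : ∀ (x : E) (C₀ : Set E) (l : List (ℝ≥0 × Set E)), MeasurableSet C₀ →
    (∀ p ∈ l, MeasurableSet p.2) → ((0 :: l.map Prod.fst).Pairwise (· < ·)) →
    (law x : Measure (Trajectory E)) {ω | ω 0 ∈ C₀ ∧ ∀ p ∈ l, ω p.1 ∈ p.2} =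
      ∫⁻ y in C₀, cylinderMass kernel 0 l y ∂(Measure.dirac x)
  /-- weak continuity of `x ↦ ℙˣ` -/
  law_continuous : Continuous law

/-! ### Optimal transport and the functional `𝒢_c` -/

/-- The set `Γ(μ, ν)` of couplings of `μ` and `ν`. -/
def couplings {X : Type*} [MeasurableSpace X] (μ ν : Measure X) : Set (Measure (X × X)) :=
  {γ | IsProbabilityMeasure γ ∧ γ.map Prod.fst = μ ∧ γ.map Prod.snd = ν}

/-- The optimal transport cost `W(k)(μ, ν) = inf {∫ k dγ | γ ∈ Γ(μ, ν)}` for a cost `k`. -/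
noncomputable def transportCost {X : Type*} [MeasurableSpace X] (k : X → X → ℝ)
    (μ ν : Measure X) : ℝ :=
  sInf ((fun γ : Measure (X × X) => ∫ p, k p.1 p.2 ∂γ) '' couplings μ ν)

/-- Membership in the lattice `𝒫`: lower semicontinuous pseudometrics bounded by `1`. -/
structure IsLscPseudometric {E : Type*} [TopologicalSpace E] (m : E → E → ℝ) : Prop where
  nonneg : ∀ x y, 0 ≤ m x y
  le_one : ∀ x y, m x y ≤ 1
  self : ∀ x, m x x = 0
  symm : ∀ x y, m x y = m y x
  triangle : ∀ x y z, m x z ≤ m x y + m y z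
  lsc : LowerSemicontinuous (fun p : E × E => m p.1 p.2)

/-- The discounted uniform pseudometric `U_c(m)(ω, ω') = sup_{t ≥ 0} cᵗ m(ω(t), ω'(t))`. -/
noncomputable def discountedUniform {E : Type*} [TopologicalSpace E] (c : ℝ) (m : E → E → ℝ)
    (ω ω' : Trajectory E) : ℝ :=
  ⨆ t : ℝ≥0, c ^ (t : ℝ) * m (ω t) (ω' t)

section

variable {E : Type*} [TopologicalSpace E] [LocallyCompactSpace E] [T2Space E]
  [SecondCountableTopology E] [MeasurableSpace E] [BorelSpace E]

/-- The functional `𝒢_c(m)(x, y) = W(U_c(m))(ℙˣ, ℙʸ)`. -/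
noncomputable def Diffusion.functional (X : Diffusion E) (c : ℝ) (m : E → E → ℝ) (x y : E) : ℝ :=
  transportCost (discountedUniform c m) (X.law x : Measure (Trajectory E)) (X.law y)

end

/-! ### The logic -/

mutual

/-- Expressions of the state logic `𝓛_σ`:  `f := q | obs | 1 - f | ∫ g`. -/
inductive StateExpr : Type
  | const (q : Set.Icc (0 : ℚ) 1) : StateExpr
  | obs : StateExpr
  | oneSub (f : StateExpr) : StateExpr
  | integral (g : TrajExpr) : StateExpr

/-- Expressions of the trajectory logic `𝓛_τ`:
`g := f ∘ ev_t | min {g₁, g₂} | max {g₁, g₂} | g ⊖ q | g ⊕ q`. -/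
inductive TrajExpr : Type
  | ev (f : StateExpr) (t : ℚ≥0) : TrajExpr
  | min (g₁ g₂ : TrajExpr) : TrajExpr
  | max (g₁ g₂ : TrajExpr) : TrajExpr
  | ominus (g : TrajExpr) (q : Set.Icc (0 : ℚ) 1) : TrajExpr
  | oplus (g : TrajExpr) (q : Set.Icc (0 : ℚ) 1) : TrajExpr

end

section

variable {E : Type*} [TopologicalSpace E] [LocallyCompactSpace E] [T2Space E]
  [SecondCountableTopology E] [MeasurableSpace E] [BorelSpace E]

mutual

/-- Interpretation of `f ∈ 𝓛_σ` as a function `E → [0,1]`, for the discount factor `c`. -/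
noncomputable def StateExpr.eval (X : Diffusion E) (obs : C(E, I)) (c : ℝ) :
    StateExpr → E → ℝ
  | .const q, _ => ((q : ℚ) : ℝ)
  | .obs, x => (obs x : ℝ)
  | .oneSub f, x => 1 - f.eval X obs c x
  | .integral g, x => ∫ ω, g.eval X obs c ω ∂(X.law x : Measure (Trajectory E))

/-- Interpretation of `g ∈ 𝓛_τ` as a function `Ω → [0,1]`, for the discount factor `c`. -/
noncomputable def TrajExpr.eval (X : Diffusion E) (obs : C(E, I)) (c : ℝ) :
    TrajExpr → Trajectory E → ℝ
  | .ev f t, ω => c ^ (t : ℝ) * f.eval X obs c (ω (t : ℝ≥0))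
  | .min g₁ g₂, ω => Min.min (g₁.eval X obs c ω) (g₂.eval X obs c ω)
  | .max g₁ g₂, ω => Max.max (g₁.eval X obs c ω) (g₂.eval X obs c ω)
  | .ominus g q, ω => Max.max 0 (g.eval X obs c ω - ((q : ℚ) : ℝ))
  | .oplus g q, ω => Min.min 1 (g.eval X obs c ω + ((q : ℚ) : ℝ))

end

/-- The pseudometric `ℓᶜ(x, y) = sup_{f ∈ 𝓛_σ} |f(x) - f(y)|`. -/
noncomputable def logicPseudometric (X : Diffusion E) (obs : C(E, I)) (c : ℝ) (x y : E) : ℝ :=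
  ⨆ f : StateExpr, |f.eval X obs c x - f.eval X obs c y|

end

end DiffusionLogic

namespace DiffusionLogic

/-! Since the logic can evaluate a trajectory at time `0`, where the laws `ℙˣ` and `ℙʸ` are
concentrated on `x` and `y`, every coupling pays at least `ℓᶜ(x, y)`, so `ℓᶜ ≤ 𝒢_c(ℓᶜ)`.

For the converse, `U_c(ℓᶜ)(ω, ω')` is a countable supremum of terms `|gᵢ(ω) - gᵢ(ω')|`, where each
`gᵢ` is of the form `f ∘ ev_t`. Finitely many of them map the trajectories into a cube with the
sup metric, and there Kantorovich-Rubinstein duality reduces the transport cost to the differences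
of integrals of 1-Lipschitz functions. A lattice version of the Stone-Weierstrass theorem
approximates these uniformly by interpretations of trajectory expressions, for which `ℓᶜ(x, y)`
bounds the difference of the integrals because `∫ g` is a state expression. A coupling of the image
laws on the cube lifts to a coupling of the laws themselves, and weak compactness of the set of
couplings passes to the supremum over all the `gᵢ`, which also shows that the infimum is
attained. -/

/-! ### Couplings on Polish spaces -/

section Polish

variable (E : Type*) [TopologicalSpace E] [LocallyCompactSpace E] [T2Space E]
  [SecondCountableTopology E]

theorem polishSpace_of_locallyCompactSpace : PolishSpace E := by
  let : MetricSpace E := TopologicalSpace.metrizableSpaceMetric E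
  have hopen : IsOpen (range ((↑) : E → UniformSpace.Completion E)) := by
    rw [isOpen_iff_mem_nhds]
    rintro _ ⟨x, rfl⟩
    obtain ⟨K, hK, hxK⟩ := exists_compact_mem_nhds x
    have h := (UniformSpace.Completion.isDenseInducing_coe (α := E)).closure_image_mem_nhds hxK
    rw [(hK.image (UniformSpace.Completion.continuous_coe E)).isClosed.closure_eq] at h
    exact mem_of_superset h (image_subset_range _ _)
  have : SecondCountableTopology (UniformSpace.Completion E) :=
    UniformSpace.secondCountable_of_separable _
  have := hopen.polishSpace
  exact (UniformSpace.Completion.isUniformEmbedding_coe E).isEmbedding.toHomeomorph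
    |>.isClosedEmbedding.polishSpace

end Polish

instance polishSpace_trajectory (E : Type*) [TopologicalSpace E] [PolishSpace E] :
    PolishSpace (Trajectory E) := by
  let := TopologicalSpace.upgradeIsCompletelyMetrizable E
  have : TopologicalSpace.IsCompletelyMetrizableSpace (Trajectory E) :=
    TopologicalSpace.IsCompletelyMetrizableSpace_of_isCompletelyPseudoMetrizableSpace
  exact {}

theorem integrable_of_mem_unitInterval {X : Type*} [MeasurableSpace X] {μ : Measure X}
    [IsFiniteMeasure μ] {f : X → ℝ} (hf : Measurable f) (hf01 : ∀ x, f x ∈ I) :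
    Integrable f μ :=
  .of_bound hf.aestronglyMeasurable 1 <| ae_of_all _ fun x => by
    rw [Real.norm_of_nonneg (hf01 x).1]
    exact (hf01 x).2

section Couplings

variable {Ω : Type*} [TopologicalSpace Ω] [MeasurableSpace Ω]

theorem continuous_integral_probabilityMeasure [OpensMeasurableSpace Ω] {g : Ω → ℝ}
    (hg : Continuous g) (hg01 : ∀ ω, g ω ∈ I) :
    Continuous fun μ : ProbabilityMeasure Ω => ∫ ω, g ω ∂(μ : Measure Ω) :=
  ProbabilityMeasure.continuous_integral_boundedContinuousFunction
    (BoundedContinuousFunction.ofNormedAddCommGroup g hg 1 fun ω => by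
      rw [Real.norm_of_nonneg (hg01 ω).1]
      exact (hg01 ω).2)

variable [PolishSpace Ω] [BorelSpace Ω] (μ ν : ProbabilityMeasure Ω)

theorem isClosed_couplings :
    IsClosed {γ : ProbabilityMeasure (Ω × Ω) | (γ : Measure (Ω × Ω)) ∈
      couplings (μ : Measure Ω) (ν : Measure Ω)} := by
  have key : {γ : ProbabilityMeasure (Ω × Ω) | (γ : Measure (Ω × Ω)) ∈
      couplings (μ : Measure Ω) (ν : Measure Ω)} =
      {γ | γ.map (continuous_fst.measurable.aemeasurable) = μ} ∩
        {γ | γ.map (continuous_snd.measurable.aemeasurable) = ν} := by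
    ext γ
    simp only [couplings, mem_ofPred_eq, mem_inter_iff,
      ← ProbabilityMeasure.toMeasure_injective.eq_iff, ProbabilityMeasure.toMeasure_map]
    exact and_iff_right inferInstance
  rw [key]
  exact (isClosed_eq (ProbabilityMeasure.continuous_map continuous_fst) continuous_const).inter
    (isClosed_eq (ProbabilityMeasure.continuous_map continuous_snd) continuous_const)

theorem isCompact_couplings :
    IsCompact {γ : ProbabilityMeasure (Ω × Ω) | (γ : Measure (Ω × Ω)) ∈
      couplings (μ : Measure Ω) (ν : Measure Ω)} := by
  rw [← (isClosed_couplings μ ν).closure_eq]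
  refine isCompact_closure_of_isTightMeasureSet (IsTightMeasureSet.prodMk ?_ ?_)
  · refine (isTightMeasureSet_singleton (μ := (μ : Measure Ω))).subset ?_
    rintro _ ⟨_, ⟨γ, hγ, rfl⟩, rfl⟩
    exact hγ.2.1
  · refine (isTightMeasureSet_singleton (μ := (ν : Measure Ω))).subset ?_
    rintro _ ⟨_, ⟨γ, hγ, rfl⟩, rfl⟩
    exact hγ.2.2

theorem exists_coupling_integral_iSup_le {k : ℕ → Ω × Ω → ℝ} (hk : ∀ n, Continuous (k n))
    (hk01 : ∀ n x, k n x ∈ I) (hmono : ∀ x, Monotone fun n => k n x) {M : ℝ}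
    (h : ∀ n, ∃ γ ∈ couplings (μ : Measure Ω) (ν : Measure Ω), ∫ x, k n x ∂γ ≤ M) :
    ∃ γ ∈ couplings (μ : Measure Ω) (ν : Measure Ω), ∫ x, ⨆ n, k n x ∂γ ≤ M := by
  let C (n : ℕ) : Set (ProbabilityMeasure (Ω × Ω)) :=
    {γ | (γ : Measure (Ω × Ω)) ∈ couplings (μ : Measure Ω) (ν : Measure Ω)} ∩
      {γ | ∫ x, k n x ∂(γ : Measure (Ω × Ω)) ≤ M}
  have hint (n : ℕ) (γ : ProbabilityMeasure (Ω × Ω)) : Integrable (k n) (γ : Measure (Ω × Ω)) :=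
    integrable_of_mem_unitInterval (hk n).measurable (hk01 n)
  have hclosed (n : ℕ) : IsClosed {γ : ProbabilityMeasure (Ω × Ω) |
      ∫ x, k n x ∂(γ : Measure (Ω × Ω)) ≤ M} :=
    isClosed_le (continuous_integral_probabilityMeasure (hk n) (hk01 n)) continuous_const
  have hanti (n : ℕ) : C (n + 1) ⊆ C n := fun γ hγ =>
    ⟨hγ.1, (integral_mono (hint n γ) (hint (n + 1) γ) fun x => hmono x n.le_succ).trans hγ.2⟩
  have hnonempty (n : ℕ) : (C n).Nonempty := by
    obtain ⟨γ, hγ, hγM⟩ := h n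
    exact ⟨⟨γ, hγ.1⟩, hγ, hγM⟩
  obtain ⟨γ, hγ⟩ := IsCompact.nonempty_iInter_of_sequence_nonempty_isCompact_isClosed C hanti
    hnonempty ((isCompact_couplings μ ν).inter_right (hclosed 0))
    fun n => (isClosed_couplings μ ν).inter (hclosed n)
  rw [mem_iInter] at hγ
  have hbdd (x : Ω × Ω) : BddAbove (range fun n => k n x) :=
    ⟨1, forall_mem_range.2 fun n => (hk01 n x).2⟩
  have hsup : Integrable (fun x => ⨆ n, k n x) (γ : Measure (Ω × Ω)) :=
    integrable_of_mem_unitInterval (.iSup fun n => (hk n).measurable) fun x =>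
      ⟨Real.iSup_nonneg fun n => (hk01 n x).1, ciSup_le fun n => (hk01 n x).2⟩
  exact ⟨γ, (hγ 0).1, le_of_tendsto' (integral_tendsto_of_tendsto_of_monotone
    (fun n => hint n γ) hsup (ae_of_all _ hmono)
    (ae_of_all _ fun x => tendsto_atTop_ciSup (hmono x) (hbdd x))) fun n => (hγ n).2⟩

end Couplings

section Lift

theorem map_fst_parallelComp_comp {X X' Y Y' : Type*} [MeasurableSpace X] [MeasurableSpace X']
    [MeasurableSpace Y] [MeasurableSpace Y'] (κ : Kernel X X') [IsSFiniteKernel κ]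
    (η : Kernel Y Y') [IsMarkovKernel η] (π : Measure (X × Y)) :
    ((κ ∥ₖ η) ∘ₘ π).map Prod.fst = κ ∘ₘ π.map Prod.fst := by
  have hκη : (κ ∥ₖ η).map Prod.fst = κ.comap Prod.fst measurable_fst := by
    ext1 p
    rw [Kernel.map_apply _ measurable_fst, Kernel.parallelComp_apply, Measure.map_fst_prod,
      measure_univ, one_smul, Kernel.comap_apply]
  rw [Measure.map_comp _ _ measurable_fst, hκη, ← Measure.deterministic_comp_eq_map measurable_fst,
    Measure.comp_assoc, Kernel.comp_deterministic_eq_comap]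

theorem map_snd_parallelComp_comp {X X' Y Y' : Type*} [MeasurableSpace X] [MeasurableSpace X']
    [MeasurableSpace Y] [MeasurableSpace Y'] (κ : Kernel X X') [IsMarkovKernel κ]
    (η : Kernel Y Y') [IsSFiniteKernel η] (π : Measure (X × Y)) :
    ((κ ∥ₖ η) ∘ₘ π).map Prod.snd = η ∘ₘ π.map Prod.snd := by
  have hκη : (κ ∥ₖ η).map Prod.snd = η.comap Prod.snd measurable_snd := by
    ext1 p
    rw [Kernel.map_apply _ measurable_snd, Kernel.parallelComp_apply, Measure.map_snd_prod,
      measure_univ, one_smul, Kernel.comap_apply]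
  rw [Measure.map_comp _ _ measurable_snd, hκη, ← Measure.deterministic_comp_eq_map measurable_snd,
    Measure.comp_assoc, Kernel.comp_deterministic_eq_comap]

variable {Ω K : Type*} [MeasurableSpace Ω] [StandardBorelSpace Ω] [MeasurableSpace K]
  [StandardBorelSpace K]

theorem ae_map_condDistrib_id_eq_dirac [Nonempty Ω] [Nonempty K] (μ : Measure Ω)
    [IsFiniteMeasure μ] {φ : Ω → K} (hφ : Measurable φ) :
    ∀ᵐ x ∂(μ.map φ), (condDistrib id φ μ x).map φ = .dirac x := by
  filter_upwards [(condDistrib_comp φ aemeasurable_id hφ).symm.trans (condDistrib_self φ)]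
    with x hx
  rwa [Kernel.map_apply _ hφ, Kernel.id_apply] at hx

theorem exists_coupling_map_prodMap_eq {μ ν : Measure Ω} [IsProbabilityMeasure μ]
    [IsProbabilityMeasure ν] {φ : Ω → K} (hφ : Measurable φ) {π : Measure (K × K)}
    (hπ : π ∈ couplings (μ.map φ) (ν.map φ)) :
    ∃ γ ∈ couplings μ ν, γ.map (Prod.map φ φ) = π := by
  obtain ⟨_, hfst, hsnd⟩ := hπ
  have : Nonempty Ω := nonempty_of_isProbabilityMeasure μ
  have : Nonempty K := this.map φ
  let κ := condDistrib id φ μ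
  let η := condDistrib id φ ν
  have hκ : ∀ᵐ p ∂π, (κ p.1).map φ = .dirac p.1 :=
    ae_of_ae_map measurable_fst.aemeasurable (hfst ▸ ae_map_condDistrib_id_eq_dirac μ hφ)
  have hη : ∀ᵐ p ∂π, (η p.2).map φ = .dirac p.2 :=
    ae_of_ae_map measurable_snd.aemeasurable (hsnd ▸ ae_map_condDistrib_id_eq_dirac ν hφ)
  refine ⟨(κ ∥ₖ η) ∘ₘ π, ⟨inferInstance, ?_, ?_⟩, ?_⟩
  · rw [map_fst_parallelComp_comp, hfst, condDistrib_comp_map hφ.aemeasurable aemeasurable_id,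
      Measure.map_id]
  · rw [map_snd_parallelComp_comp, hsnd, condDistrib_comp_map hφ.aemeasurable aemeasurable_id,
      Measure.map_id]
  · calc ((κ ∥ₖ η) ∘ₘ π).map (Prod.map φ φ) = π.bind .dirac := by
          rw [Measure.map_comp _ _ (hφ.prodMap hφ)]
          refine Measure.bind_congr_right ?_
          filter_upwards [hκ, hη] with p hκp hηp
          rw [Kernel.map_apply _ (hφ.prodMap hφ), Kernel.parallelComp_apply,
            ← Measure.map_prod_map _ _ hφ hφ, hκp, hηp, Measure.dirac_prod_dirac]
      _ = π := Measure.bind_dirac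

end Lift

/-! ### Kantorovich duality on compact spaces -/

section Kantorovich

open scoped CompactlySupported in
theorem exists_isProbabilityMeasure_forall_integral_eq {X : Type*} [TopologicalSpace X]
    [CompactSpace X] [T2Space X] [MeasurableSpace X] [BorelSpace X] (Λ : C(X, ℝ) →ₗ[ℝ] ℝ)
    (hΛ : ∀ f, 0 ≤ f → 0 ≤ Λ f) (hΛ1 : Λ 1 = 1) :
    ∃ μ : Measure X, IsProbabilityMeasure μ ∧ ∀ f : C(X, ℝ), ∫ x, f x ∂μ = Λ f := by
  let Λ' : C_c(X, ℝ) →ₚ[ℝ] ℝ :=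
    .mk₀ (Λ ∘ₗ { toFun f := f.toContinuousMap, map_add' _ _ := rfl, map_smul' _ _ := rfl })
      fun f hf => hΛ f.toContinuousMap hf
  have hint (f : C(X, ℝ)) : ∫ x, f x ∂(RealRMK.rieszMeasure Λ') = Λ f :=
    RealRMK.integral_rieszMeasure Λ' ⟨f, .of_compactSpace f⟩
  refine ⟨RealRMK.rieszMeasure Λ', ⟨?_⟩, hint⟩
  have := hint 1
  simpa [hΛ1, measureReal_def, ENNReal.toReal_eq_one_iff] using this

/-- The functions `(x, y) ↦ a x + b y` on `K × K` with `a` and `b` continuous: the integral of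
such a function has the same value against all couplings of two measures. -/
def separatedSums (K : Type*) [TopologicalSpace K] : Submodule ℝ C(K × K, ℝ) where
  carrier := {F | ∃ a b : C(K, ℝ), ∀ p, F p = a p.1 + b p.2}
  zero_mem' := ⟨0, 0, fun _ => by simp⟩
  add_mem' := by
    rintro F G ⟨a, b, hF⟩ ⟨a', b', hG⟩
    refine ⟨a + a', b + b', fun p => ?_⟩
    simp only [ContinuousMap.add_apply, hF, hG]
    ring
  smul_mem' := by
    rintro r F ⟨a, b, hF⟩
    refine ⟨r • a, r • b, fun p => ?_⟩
    simp only [ContinuousMap.smul_apply, hF, smul_add]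

/-- The convex cone generated by the nonnegative functions and `M - k`: a positive functional on
it is a nonnegative measure for which the integral of `k` is at most `M` times its mass. -/
def budgetCone {X : Type*} [TopologicalSpace X] (k : C(X, ℝ)) (M : ℝ) :
    PointedCone ℝ C(X, ℝ) where
  carrier := {F | ∃ r : ℝ, 0 ≤ r ∧ ∀ x, r * (M - k x) ≤ F x}
  zero_mem' := ⟨0, le_rfl, fun _ => by simp⟩
  add_mem' := by
    rintro F G ⟨r, hr, hF⟩ ⟨s, hs, hG⟩
    refine ⟨r + s, add_nonneg hr hs, fun x => ?_⟩
    rw [add_mul]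
    exact add_le_add (hF x) (hG x)
  smul_mem' := by
    rintro ⟨t, ht⟩ F ⟨r, hr, hF⟩
    refine ⟨t * r, mul_nonneg ht hr, fun x => ?_⟩
    rw [mul_assoc]
    exact mul_le_mul_of_nonneg_left (hF x) ht

theorem mem_budgetCone_of_nonneg {X : Type*} [TopologicalSpace X] (k : C(X, ℝ)) (M : ℝ)
    {F : C(X, ℝ)} (hF : 0 ≤ F) : F ∈ budgetCone k M :=
  ⟨0, le_rfl, fun x => by simpa using hF x⟩

theorem integrable_continuousMap {X : Type*} [TopologicalSpace X] [CompactSpace X]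
    [MeasurableSpace X] [OpensMeasurableSpace X] (μ : Measure X) [IsFiniteMeasure μ]
    (f : C(X, ℝ)) : Integrable f μ :=
  f.continuous.integrable_of_hasCompactSupport (.of_compactSpace f)

section Duality

variable {K : Type*} [TopologicalSpace K] [CompactSpace K] [SecondCountableTopology K]
  [MeasurableSpace K] [BorelSpace K] (μ ν : Measure K) [IsProbabilityMeasure μ]
  [IsProbabilityMeasure ν]

theorem integral_prod_of_eq_add {F : C(K × K, ℝ)} {a b : C(K, ℝ)}
    (hF : ∀ p, F p = a p.1 + b p.2) :
    ∫ p, F p ∂(μ.prod ν) = ∫ x, a x ∂μ + ∫ y, b y ∂ν := by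
  simp_rw [hF]
  rw [integral_add ((integrable_continuousMap μ a).comp_fst ν)
    ((integrable_continuousMap ν b).comp_snd μ), integral_fun_fst, integral_fun_snd]
  simp

theorem integral_prod_nonneg_of_mem_budgetCone {k : C(K × K, ℝ)} {M : ℝ}
    (h : ∀ a b : C(K, ℝ), (∀ x y, a x + b y ≤ k (x, y)) → ∫ x, a x ∂μ + ∫ y, b y ∂ν ≤ M)
    {F : C(K × K, ℝ)} (hF : F ∈ separatedSums K) (hFk : F ∈ budgetCone k M) :
    0 ≤ ∫ p, F p ∂(μ.prod ν) := by
  obtain ⟨a, b, hab⟩ := hF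
  obtain ⟨r, hr, hrF⟩ := hFk
  rcases hr.eq_or_lt with rfl | hr
  · exact integral_nonneg fun p => by simpa using hrF p
  have hdual := h (.const K M - r⁻¹ • a) (-(r⁻¹ • b)) fun x y => by
    have hxy := mul_le_mul_of_nonneg_left (hrF (x, y)) (inv_nonneg.2 hr.le)
    simp only [ContinuousMap.sub_apply, ContinuousMap.const_apply, ContinuousMap.smul_apply,
      ContinuousMap.neg_apply, smul_eq_mul, hab, inv_mul_cancel_left₀ hr.ne', mul_add] at hxy ⊢
    linarith
  simp only [ContinuousMap.sub_apply, ContinuousMap.const_apply, ContinuousMap.smul_apply,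
    ContinuousMap.neg_apply, smul_eq_mul, integral_neg, integral_const_mul] at hdual
  rw [integral_sub (integrable_const M) ((integrable_continuousMap μ a).const_mul _),
    integral_const_mul, integral_const, probReal_univ, one_smul] at hdual
  rw [integral_prod_of_eq_add μ ν hab]
  refine nonneg_of_mul_nonneg_right (a := r⁻¹) ?_ (inv_pos.2 hr)
  rw [mul_add]
  linarith

theorem exists_coupling_integral_le_of_forall_integral_add_le [T2Space K] {k : C(K × K, ℝ)} {M : ℝ}
    (h : ∀ a b : C(K, ℝ), (∀ x y, a x + b y ≤ k (x, y)) → ∫ x, a x ∂μ + ∫ y, b y ∂ν ≤ M) :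
    ∃ γ ∈ couplings μ ν, ∫ p, k p ∂γ ≤ M := by
  let integralProd : C(K × K, ℝ) →ₗ[ℝ] ℝ :=
    { toFun F := ∫ p, F p ∂(μ.prod ν)
      map_add' F G := integral_add (integrable_continuousMap _ F) (integrable_continuousMap _ G)
      map_smul' r F := integral_const_mul r F }
  obtain ⟨Λ, hΛV, hΛpos⟩ := riesz_extension (budgetCone k M)
    ⟨separatedSums K, integralProd.domRestrict (separatedSums K)⟩
    (fun F hF => integral_prod_nonneg_of_mem_budgetCone μ ν h F.2 hF)
    (fun F => ⟨⟨.const _ ‖F‖, .const K ‖F‖, 0, fun p => by simp⟩,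
      mem_budgetCone_of_nonneg k M fun p => neg_le_iff_add_nonneg'.1 (F.neg_norm_le_apply p)⟩)
  have hΛ {F : C(K × K, ℝ)} {a b : C(K, ℝ)} (hF : ∀ p, F p = a p.1 + b p.2) :
      Λ F = ∫ x, a x ∂μ + ∫ y, b y ∂ν :=
    (hΛV ⟨F, a, b, hF⟩).trans (integral_prod_of_eq_add μ ν hF)
  obtain ⟨γ, hγ, hγΛ⟩ := exists_isProbabilityMeasure_forall_integral_eq Λ
    (fun F hF => hΛpos F (mem_budgetCone_of_nonneg k M hF))
    ((hΛ (a := 1) (b := 0) fun p => by simp).trans (by simp))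
  refine ⟨γ, ⟨hγ, ?_, ?_⟩, ?_⟩
  · refine ext_of_forall_integral_eq_of_IsFiniteMeasure fun f => ?_
    rw [integral_map measurable_fst.aemeasurable f.continuous.aestronglyMeasurable]
    exact (hγΛ (f.toContinuousMap.comp .fst)).trans
      ((hΛ (a := f.toContinuousMap) (b := 0) fun p => by simp).trans (by simp))
  · refine ext_of_forall_integral_eq_of_IsFiniteMeasure fun f => ?_
    rw [integral_map measurable_snd.aemeasurable f.continuous.aestronglyMeasurable]
    exact (hγΛ (f.toContinuousMap.comp .snd)).trans
      ((hΛ (a := 0) (b := f.toContinuousMap) fun p => by simp).trans (by simp))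
  · have hMk : 0 ≤ ∫ p, (M - k p) ∂γ :=
      (hΛpos (.const _ M - k) ⟨1, zero_le_one, fun p => by simp⟩).trans_eq (hγΛ _).symm
    rw [integral_sub (integrable_const M) (integrable_continuousMap γ k), integral_const,
      probReal_univ, one_smul] at hMk
    exact sub_nonneg.1 hMk

end Duality

theorem exists_coupling_integral_dist_le {K : Type*} [MetricSpace K] [CompactSpace K]
    [MeasurableSpace K] [BorelSpace K] (μ ν : Measure K) [IsProbabilityMeasure μ]
    [IsProbabilityMeasure ν] {M : ℝ}
    (h : ∀ f : K → ℝ, LipschitzWith 1 f → ∫ x, f x ∂μ - ∫ x, f x ∂ν ≤ M) :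
    ∃ γ ∈ couplings μ ν, ∫ p, dist p.1 p.2 ∂γ ≤ M := by
  have : Nonempty K := nonempty_of_isProbabilityMeasure μ
  refine exists_coupling_integral_le_of_forall_integral_add_le μ ν
    (k := ⟨fun p => dist p.1 p.2, continuous_dist⟩) fun a b hab => ?_
  let f : K → ℝ := fun x => ⨅ y, (dist x y - b y)
  have hbdd (x : K) : BddBelow (range fun y => dist x y - b y) :=
    ⟨a x, forall_mem_range.2 fun y => le_sub_iff_add_le.2 (hab x y)⟩
  have hf : LipschitzWith 1 f := .of_le_add fun x x' => by
    rw [← sub_le_iff_le_add]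
    refine le_ciInf fun y => ?_
    have hle : f x ≤ dist x y - b y := ciInf_le (hbdd x) y
    linarith [dist_triangle x x' y]
  have haf (x : K) : a x ≤ f x := le_ciInf fun y => le_sub_iff_add_le.2 (hab x y)
  have hfb (y : K) : f y ≤ -b y := (ciInf_le (hbdd y) y).trans_eq (by simp)
  have hfμ (ρ : Measure K) [IsProbabilityMeasure ρ] : Integrable f ρ :=
    integrable_continuousMap ρ ⟨f, hf.continuous⟩
  calc ∫ x, a x ∂μ + ∫ y, b y ∂ν ≤ ∫ x, f x ∂μ - ∫ y, f y ∂ν := by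
        have h₁ := integral_mono (integrable_continuousMap μ a) (hfμ μ) haf
        have h₂ := integral_mono (hfμ ν) (integrable_continuousMap ν b).neg hfb
        simp only [Pi.neg_apply, integral_neg] at h₂
        linarith
    _ ≤ M := h f hf

end Kantorovich

/-! ### Lattice approximation of Lipschitz functions -/

section LatticeApproximation

/-- Closure of a set of functions under the connectives `min`, `max`, `⊖ q`, `⊕ q` of the
trajectory logic. -/
structure IsClosedUnderConnectives {Ω : Type*} (A : Set (Ω → ℝ)) : Prop where
  inf : ∀ f ∈ A, ∀ g ∈ A, f ⊓ g ∈ A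
  sup : ∀ f ∈ A, ∀ g ∈ A, f ⊔ g ∈ A
  ominus : ∀ f ∈ A, ∀ q : Set.Icc (0 : ℚ) 1, (fun ω => max 0 (f ω - ((q : ℚ) : ℝ))) ∈ A
  oplus : ∀ f ∈ A, ∀ q : Set.Icc (0 : ℚ) 1, (fun ω => min 1 (f ω + ((q : ℚ) : ℝ))) ∈ A

theorem exists_rat_mem_Icc_abs_sub_le {x ε : ℝ} (hx : x ∈ I) (hε : 0 < ε) :
    ∃ q : Set.Icc (0 : ℚ) 1, |((q : ℚ) : ℝ) - x| ≤ ε := by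
  obtain ⟨q, hxq, hqx⟩ := exists_rat_btwn (lt_add_of_pos_right x hε)
  have hq : 0 ≤ q := by exact_mod_cast hx.1.trans hxq.le
  refine ⟨⟨min q 1, le_min hq zero_le_one, min_le_right _ _⟩, ?_⟩
  rw [Rat.cast_min, Rat.cast_one, abs_of_nonneg (sub_nonneg.2 (le_min hxq.le hx.2)),
    sub_le_iff_le_add']
  exact (min_le_left _ _).trans hqx.le

namespace IsClosedUnderConnectives

variable {Ω : Type*} {A : Set (Ω → ℝ)}

theorem setOf_sub_le (hA : IsClosedUnderConnectives A) {k : Ω → Ω → ℝ}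
    (hk : ∀ ω ω', 0 ≤ k ω ω') :
    IsClosedUnderConnectives {g ∈ A | ∀ ω ω', g ω - g ω' ≤ k ω ω'} where
  inf := fun f ⟨hf, hfk⟩ g ⟨hg, hgk⟩ => ⟨hA.inf f hf g hg, fun ω ω' => by
    simp only [Pi.inf_apply]
    grind⟩
  sup := fun f ⟨hf, hfk⟩ g ⟨hg, hgk⟩ => ⟨hA.sup f hf g hg, fun ω ω' => by
    simp only [Pi.sup_apply]
    grind⟩
  ominus := fun f ⟨hf, hfk⟩ q => ⟨hA.ominus f hf q, fun ω ω' => by grind⟩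
  oplus := fun f ⟨hf, hfk⟩ q => ⟨hA.oplus f hf q, fun ω ω' => by grind⟩

theorem exists_two_point_approx_of_le (hA : IsClosedUnderConnectives A) {ω ω' : Ω} {g : Ω → ℝ}
    (hg : g ∈ A) (hg0 : 0 ≤ g ω') (hg1 : g ω ≤ 1) {a b : ℝ} (hb : 0 ≤ b) (ha : a ≤ 1)
    (hba : b ≤ a) (hab : a - b ≤ g ω - g ω') {ε : ℝ} (hε : 0 < ε) :
    ∃ f ∈ A, |f ω - a| ≤ ε ∧ |f ω' - b| ≤ ε := by
  obtain ⟨q, hq⟩ := exists_rat_mem_Icc_abs_sub_le (x := g ω - (a - b))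
    ⟨by linarith, by linarith⟩ (half_pos hε)
  obtain ⟨r, hr⟩ := exists_rat_mem_Icc_abs_sub_le ⟨hb, hba.trans ha⟩ (half_pos hε)
  refine ⟨_, hA.oplus _ (hA.ominus g hg q) r, ?_, ?_⟩
  all_goals
    rw [abs_le] at *
    grind

theorem exists_two_point_approx (hA : IsClosedUnderConnectives A)
    (hA01 : ∀ g ∈ A, ∀ ω, g ω ∈ I) {h : Ω → ℝ} (h01 : ∀ ω, h ω ∈ I)
    (hh : ∀ ω ω', ∃ g ∈ A, h ω - h ω' ≤ g ω - g ω') (ω ω' : Ω) {ε : ℝ} (hε : 0 < ε) :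
    ∃ f ∈ A, |f ω - h ω| ≤ ε ∧ |f ω' - h ω'| ≤ ε := by
  wlog hle : h ω' ≤ h ω generalizing ω ω'
  · obtain ⟨f, hf, hfω', hfω⟩ := this ω' ω (le_of_not_ge hle)
    exact ⟨f, hf, hfω, hfω'⟩
  obtain ⟨g, hg, hhg⟩ := hh ω ω'
  exact hA.exists_two_point_approx_of_le hg (hA01 g hg _).1 (hA01 g hg _).2 (h01 ω').1 (h01 ω).2
    hle hhg hε

theorem exists_finset_approx (hA : IsClosedUnderConnectives A)
    (hA01 : ∀ g ∈ A, ∀ ω, g ω ∈ I) {h : Ω → ℝ} (h01 : ∀ ω, h ω ∈ I)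
    (hh : ∀ ω ω', ∃ g ∈ A, h ω - h ω' ≤ g ω - g ω') {S : Finset Ω} (hS : S.Nonempty)
    {ε : ℝ} (hε : 0 < ε) :
    ∃ f ∈ A, ∀ ω ∈ S, |f ω - h ω| ≤ ε := by
  choose f hfA hfl hfr using fun ω ω' => hA.exists_two_point_approx hA01 h01 hh ω ω' hε
  refine ⟨S.sup' hS fun ω => S.inf' hS fun ω' => f ω ω', ?_, fun ω hω => ?_⟩
  · exact Finset.sup'_induction _ _ hA.sup fun ω _ =>
      Finset.inf'_induction _ _ hA.inf fun ω' _ => hfA ω ω'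
  · simp only [Finset.sup'_apply, Finset.inf'_apply]
    rw [abs_sub_le_iff, sub_le_iff_le_add', sub_le_comm]
    constructor
    · refine Finset.sup'_le _ _ fun ω' _ => (Finset.inf'_le _ hω).trans ?_
      linarith [(abs_le.1 (hfr ω' ω)).2]
    · refine (Finset.le_inf' hS _ fun ω' _ => ?_).trans
        (Finset.le_sup' (fun ω' => S.inf' hS fun ω'' => f ω' ω'' ω) hω)
      linarith [(abs_le.1 (hfl ω ω')).1]

theorem exists_uniform_approx [PseudoMetricSpace Ω] [Nonempty Ω]
    (hΩ : TotallyBounded (univ : Set Ω)) (hA : IsClosedUnderConnectives A)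
    (hA01 : ∀ g ∈ A, ∀ ω, g ω ∈ I) (hAlip : ∀ g ∈ A, LipschitzWith 1 g)
    (hAsep : ∀ ω ω', ∃ g ∈ A, dist ω ω' ≤ g ω - g ω') {h : Ω → ℝ} (h01 : ∀ ω, h ω ∈ I)
    (hh : LipschitzWith 1 h) {ε : ℝ} (hε : 0 < ε) :
    ∃ f ∈ A, ∀ ω, |f ω - h ω| ≤ ε := by
  have hε3 : 0 < ε / 3 := by positivity
  obtain ⟨T, hT, hcover⟩ := Metric.totallyBounded_iff.1 hΩ (ε / 3) hε3
  have hcover' (ω : Ω) : ∃ ω' ∈ hT.toFinset, dist ω ω' < ε / 3 := by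
    simpa using hcover (mem_univ ω)
  have hS : hT.toFinset.Nonempty := (hcover' (Classical.arbitrary Ω)).imp fun _ h => h.1
  obtain ⟨f, hf, hfh⟩ := hA.exists_finset_approx hA01 h01 (fun ω ω' => by
    obtain ⟨g, hg, hdist⟩ := hAsep ω ω'
    exact ⟨g, hg, (Real.sub_le_dist _ _).trans ((hh.dist_le_mul ω ω').trans (by simpa))⟩) hS hε3
  refine ⟨f, hf, fun ω => ?_⟩
  obtain ⟨ω', hω', hdist⟩ := hcover' ω
  have hfω : |f ω - f ω'| ≤ dist ω ω' := by
    simpa [Real.dist_eq] using (hAlip f hf).dist_le_mul ω ω'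
  have hhω : |h ω' - h ω| ≤ dist ω ω' := by
    simpa [Real.dist_eq, dist_comm ω] using hh.dist_le_mul ω' ω
  calc |f ω - h ω| ≤ |f ω - f ω'| + |f ω' - h ω'| + |h ω' - h ω| :=
        (abs_sub_le _ _ _).trans (add_le_add_left (abs_sub_le _ _ _) _)
    _ ≤ ε := by linarith [hfh ω' hω']

end IsClosedUnderConnectives

end LatticeApproximation

section TransportAgainstConnectives

namespace IsClosedUnderConnectives

variable {Ω : Type*} [MeasurableSpace Ω] {A : Set (Ω → ℝ)} {M : ℝ}

theorem integral_sub_integral_le_of_lipschitzWith [PseudoMetricSpace Ω]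
    (hΩ : TotallyBounded (univ : Set Ω)) (hA : IsClosedUnderConnectives A)
    (hA01 : ∀ g ∈ A, ∀ ω, g ω ∈ I) (hAm : ∀ g ∈ A, Measurable g)
    (hAlip : ∀ g ∈ A, LipschitzWith 1 g) (hAsep : ∀ ω ω', ∃ g ∈ A, dist ω ω' ≤ g ω - g ω')
    {μ ν : Measure Ω} [IsProbabilityMeasure μ] [IsProbabilityMeasure ν]
    (hAM : ∀ g ∈ A, ∫ ω, g ω ∂μ - ∫ ω, g ω ∂ν ≤ M) {h : Ω → ℝ} (h01 : ∀ ω, h ω ∈ I)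
    (hm : Measurable h) (hh : LipschitzWith 1 h) :
    ∫ ω, h ω ∂μ - ∫ ω, h ω ∂ν ≤ M := by
  have : Nonempty Ω := nonempty_of_isProbabilityMeasure μ
  refine le_of_forall_pos_le_add fun ε hε => ?_
  obtain ⟨g, hg, hgh⟩ := hA.exists_uniform_approx hΩ hA01 hAlip hAsep h01 hh (half_pos hε)
  have hintegral (ρ : Measure Ω) [IsProbabilityMeasure ρ] :
      |∫ ω, g ω ∂ρ - ∫ ω, h ω ∂ρ| ≤ ε / 2 := by
    rw [← integral_sub (integrable_of_mem_unitInterval (hAm g hg) (hA01 g hg))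
      (integrable_of_mem_unitInterval hm h01)]
    simpa using norm_integral_le_of_norm_le_const (μ := ρ) (f := fun ω => g ω - h ω) (C := ε / 2)
      (ae_of_all _ hgh)
  have hμ := (abs_le.1 (hintegral μ)).1
  have hν := (abs_le.1 (hintegral ν)).2
  linarith [hAM g hg]

section Pushforward

variable {K : Type*} [MetricSpace K] [CompactSpace K] [MeasurableSpace K] [BorelSpace K]
  {φ : Ω → K} {μ ν : Measure Ω} [IsProbabilityMeasure μ] [IsProbabilityMeasure ν]

theorem integral_map_sub_integral_map_le_of_lipschitzWith (hφ : Measurable φ)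
    (hdist : ∀ x y : K, dist x y ≤ 1) (hA : IsClosedUnderConnectives A)
    (hA01 : ∀ g ∈ A, ∀ ω, g ω ∈ I) (hAm : ∀ g ∈ A, Measurable g)
    (hAlip : ∀ g ∈ A, ∀ ω ω', g ω - g ω' ≤ dist (φ ω) (φ ω'))
    (hAsep : ∀ ω ω', ∃ g ∈ A, dist (φ ω) (φ ω') ≤ g ω - g ω')
    (hAM : ∀ g ∈ A, ∫ ω, g ω ∂μ - ∫ ω, g ω ∂ν ≤ M) {f : K → ℝ} (hf : LipschitzWith 1 f) :
    ∫ x, f x ∂(μ.map φ) - ∫ x, f x ∂(ν.map φ) ≤ M := by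
  have : Nonempty K := (nonempty_of_isProbabilityMeasure μ).map φ
  let : PseudoMetricSpace Ω := .induced φ inferInstance
  have hΩ : TotallyBounded (univ : Set Ω) :=
    totallyBounded_preimage (f := φ) ⟨rfl⟩ (s := univ) isCompact_univ.totallyBounded
  have hflip (x y : K) : f x - f y ≤ dist x y := by
    simpa using (Real.sub_le_dist _ _).trans (hf.dist_le_mul x y)
  obtain ⟨x₀, -, hx₀⟩ := isCompact_univ.exists_isMinOn univ_nonempty hf.continuous.continuousOn
  let h (ω : Ω) : ℝ := f (φ ω) - f x₀
  have h01 (ω : Ω) : h ω ∈ I := ⟨sub_nonneg.2 (hx₀ (mem_univ _)), (hflip _ _).trans (hdist _ _)⟩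
  have hm : Measurable h := (hf.continuous.measurable.comp hφ).sub_const _
  have hlip : LipschitzWith 1 h := .of_le_add fun ω ω' => by
    rw [← sub_le_iff_le_add', sub_sub_sub_cancel_right]
    exact hflip _ _
  have hshift (ρ : Measure Ω) [IsProbabilityMeasure ρ] :
      ∫ x, f x ∂(ρ.map φ) = ∫ ω, h ω ∂ρ + f x₀ := by
    have hfh : (fun ω => f (φ ω)) = fun ω => h ω + f x₀ := funext fun ω => (sub_add_cancel _ _).symm
    rw [integral_map hφ.aemeasurable hf.continuous.aestronglyMeasurable, hfh,
      integral_add (integrable_of_mem_unitInterval hm h01) (integrable_const _)]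
    simp
  rw [hshift μ, hshift ν, add_sub_add_right_eq_sub]
  exact hA.integral_sub_integral_le_of_lipschitzWith hΩ hA01 hAm
    (fun g hg => .of_le_add fun ω ω' => sub_le_iff_le_add'.1 (hAlip g hg ω ω'))
    hAsep hAM h01 hm hlip

theorem exists_coupling_integral_dist_comp_le [StandardBorelSpace Ω] (hφ : Measurable φ)
    (hdist : ∀ x y : K, dist x y ≤ 1) (hA : IsClosedUnderConnectives A)
    (hA01 : ∀ g ∈ A, ∀ ω, g ω ∈ I) (hAm : ∀ g ∈ A, Measurable g)
    (hAlip : ∀ g ∈ A, ∀ ω ω', g ω - g ω' ≤ dist (φ ω) (φ ω'))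
    (hAsep : ∀ ω ω', ∃ g ∈ A, dist (φ ω) (φ ω') ≤ g ω - g ω')
    (hAM : ∀ g ∈ A, ∫ ω, g ω ∂μ - ∫ ω, g ω ∂ν ≤ M) :
    ∃ γ ∈ couplings μ ν, ∫ p, dist (φ p.1) (φ p.2) ∂γ ≤ M := by
  have := Measure.isProbabilityMeasure_map (μ := μ) hφ.aemeasurable
  have := Measure.isProbabilityMeasure_map (μ := ν) hφ.aemeasurable
  obtain ⟨π, hπ, hπM⟩ := exists_coupling_integral_dist_le (μ.map φ) (ν.map φ) fun f hf =>
    hA.integral_map_sub_integral_map_le_of_lipschitzWith hφ hdist hA01 hAm hAlip hAsep hAM hf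
  obtain ⟨γ, hγ, rfl⟩ := exists_coupling_map_prodMap_eq hφ hπ
  rw [integral_map (hφ.prodMap hφ).aemeasurable measurable_dist.aestronglyMeasurable] at hπM
  exact ⟨γ, hγ, hπM⟩

end Pushforward

end IsClosedUnderConnectives

theorem dist_pi_eq_iSup {ι : Type*} [Fintype ι] [Nonempty ι] {X : ι → Type*}
    [∀ i, PseudoMetricSpace (X i)] (f g : ∀ i, X i) : dist f g = ⨆ i, dist (f i) (g i) :=
  le_antisymm ((dist_pi_le_iff (Real.iSup_nonneg fun _ => dist_nonneg)).2 fun i =>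
    le_ciSup (f := fun i => dist (f i) (g i)) (finite_range _).bddAbove i)
    (ciSup_le fun i => dist_le_pi_dist f g i)

theorem exists_mem_iSup_abs_sub_eq {Ω ι : Type*} [Finite ι] [Nonempty ι] {A : Set (Ω → ℝ)}
    {g : ι → Ω → ℝ} (hg : ∀ i, g i ∈ A) (hflip : ∀ i, ∃ r : ℝ, (fun ω => r - g i ω) ∈ A)
    (ω ω' : Ω) :
    ∃ f ∈ A, (∀ ω ω', f ω - f ω' ≤ ⨆ i, |g i ω - g i ω'|) ∧
      ⨆ i, |g i ω - g i ω'| = f ω - f ω' := by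
  obtain ⟨i, hi⟩ := exists_eq_ciSup_of_finite (f := fun i => |g i ω - g i ω'|)
  have hle (ω ω' : Ω) : |g i ω - g i ω'| ≤ ⨆ i, |g i ω - g i ω'| :=
    le_ciSup (f := fun i => |g i ω - g i ω'|) (finite_range _).bddAbove i
  rw [← hi]
  rcases abs_choice (g i ω - g i ω') with habs | habs
  · exact ⟨g i, hg i, fun ω ω' => (le_abs_self _).trans (hle ω ω'), habs⟩
  · obtain ⟨r, hr⟩ := hflip i
    exact ⟨_, hr, fun ω ω' => by linarith [neg_abs_le (g i ω - g i ω'), hle ω ω'],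
      by linarith⟩

namespace IsClosedUnderConnectives

variable {Ω ι : Type*} [MeasurableSpace Ω] {A : Set (Ω → ℝ)} {M : ℝ} [Nonempty ι] {g : ι → Ω → ℝ}

theorem exists_coupling_integral_iSup_abs_sub_le_of_finite [StandardBorelSpace Ω] [Finite ι]
    (hA : IsClosedUnderConnectives A) (hA01 : ∀ g ∈ A, ∀ ω, g ω ∈ I)
    (hAm : ∀ g ∈ A, Measurable g) {μ ν : Measure Ω} [IsProbabilityMeasure μ]
    [IsProbabilityMeasure ν] (hAM : ∀ g ∈ A, ∫ ω, g ω ∂μ - ∫ ω, g ω ∂ν ≤ M)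
    (hg : ∀ i, g i ∈ A) (hflip : ∀ i, ∃ r : ℝ, (fun ω => r - g i ω) ∈ A) :
    ∃ γ ∈ couplings μ ν, ∫ p, ⨆ i, |g i p.1 - g i p.2| ∂γ ≤ M := by
  have := Fintype.ofFinite ι
  let φ : Ω → ι → I := fun ω i => ⟨g i ω, hA01 _ (hg i) ω⟩
  have hφ : Measurable φ := measurable_pi_lambda _ fun i => (hAm _ (hg i)).subtype_mk
  have hφdist (ω ω' : Ω) : ⨆ i, |g i ω - g i ω'| = dist (φ ω) (φ ω') :=
    (dist_pi_eq_iSup (φ ω) (φ ω')).symm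
  simp_rw [hφdist]
  refine (hA.setOf_sub_le (k := fun ω ω' => dist (φ ω) (φ ω')) fun _ _ =>
    dist_nonneg).exists_coupling_integral_dist_comp_le hφ
    (fun x y => (dist_pi_le_iff zero_le_one).2 fun i => Real.dist_le_of_mem_Icc_01 (x i).2 (y i).2)
    (fun f hf => hA01 f hf.1) (fun f hf => hAm f hf.1) (fun f hf => hf.2) (fun ω ω' => ?_)
    fun f hf => hAM f hf.1
  obtain ⟨f, hf, hfle, hfeq⟩ := exists_mem_iSup_abs_sub_eq hg hflip ω ω'
  simp_rw [hφdist] at hfle hfeq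
  exact ⟨f, ⟨hf, hfle⟩, hfeq.le⟩

theorem exists_coupling_integral_iSup_abs_sub_le [TopologicalSpace Ω] [PolishSpace Ω] [BorelSpace Ω]
    [Countable ι] (hA : IsClosedUnderConnectives A) (hA01 : ∀ g ∈ A, ∀ ω, g ω ∈ I)
    (hAm : ∀ g ∈ A, Measurable g) {μ ν : ProbabilityMeasure Ω}
    (hAM : ∀ g ∈ A, ∫ ω, g ω ∂(μ : Measure Ω) - ∫ ω, g ω ∂(ν : Measure Ω) ≤ M)
    (hg : ∀ i, g i ∈ A) (hgc : ∀ i, Continuous (g i))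
    (hflip : ∀ i, ∃ r : ℝ, (fun ω => r - g i ω) ∈ A) :
    ∃ γ ∈ couplings (μ : Measure Ω) (ν : Measure Ω), ∫ p, ⨆ i, |g i p.1 - g i p.2| ∂γ ≤ M := by
  obtain ⟨e, he⟩ := exists_surjective_nat ι
  let d (n : ℕ) (p : Ω × Ω) : ℝ := |g (e n) p.1 - g (e n) p.2|
  have hd1 (n : ℕ) (p : Ω × Ω) : d n p ≤ 1 :=
    Real.dist_le_of_mem_Icc_01 (hA01 _ (hg _) _) (hA01 _ (hg _) _)
  have hk (n : ℕ) (p : Ω × Ω) : partialSups d n p = ⨆ i : Iic n, d i p := by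
    simp only [Pi.partialSups_apply, partialSups_eq_ciSup_Iic]
  have hk01 (n : ℕ) (p : Ω × Ω) : partialSups d n p ∈ I := by
    rw [hk]
    exact ⟨Real.iSup_nonneg fun _ => abs_nonneg _, ciSup_le fun i => hd1 i p⟩
  have hsup (p : Ω × Ω) : ⨆ n, partialSups d n p = ⨆ i, |g i p.1 - g i p.2| := by
    simp_rw [Pi.partialSups_apply]
    rw [ciSup_partialSups_eq ⟨1, forall_mem_range.2 fun n => hd1 n p⟩]
    exact he.iSup_comp (g := fun i => |g i p.1 - g i p.2|)
  simp only [← hsup]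
  refine exists_coupling_integral_iSup_le μ ν (k := partialSups d)
    (fun n => .partialSups fun m _ =>
      (((hgc _).comp continuous_fst).sub ((hgc _).comp continuous_snd)).abs)
    hk01 (fun p m n hmn => (partialSups d).monotone hmn p) fun n => ?_
  simp_rw [hk]
  exact hA.exists_coupling_integral_iSup_abs_sub_le_of_finite hA01 hAm hAM
    (fun i : Iic n => hg (e i)) fun i => hflip (e i)

end IsClosedUnderConnectives

end TransportAgainstConnectives

/-! ### Discounted transport of behavioural distances -/

section DiscountedUniform

theorem rpow_mem_unitInterval {c : ℝ} (hc : c ∈ I) (t : ℝ≥0) : c ^ (t : ℝ) ∈ I :=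
  ⟨Real.rpow_nonneg hc.1 _, Real.rpow_le_one hc.1 hc.2 t.2⟩

variable {E : Type*} [TopologicalSpace E] {c : ℝ} {m : E → E → ℝ}

theorem IsLscPseudometric.discounted_mem_unitInterval (hm : IsLscPseudometric m) (hc : c ∈ I)
    (t : ℝ≥0) (x y : E) : c ^ (t : ℝ) * m x y ∈ I :=
  unitInterval.mul_mem (rpow_mem_unitInterval hc t) ⟨hm.nonneg _ _, hm.le_one _ _⟩

theorem IsLscPseudometric.bddAbove_range_discounted (hm : IsLscPseudometric m) (hc : c ∈ I)
    (ω ω' : Trajectory E) : BddAbove (range fun t : ℝ≥0 => c ^ (t : ℝ) * m (ω t) (ω' t)) :=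
  ⟨1, forall_mem_range.2 fun t => (hm.discounted_mem_unitInterval hc t _ _).2⟩

theorem IsLscPseudometric.le_discountedUniform (hm : IsLscPseudometric m) (hc : c ∈ I)
    (ω ω' : Trajectory E) (t : ℝ≥0) :
    c ^ (t : ℝ) * m (ω t) (ω' t) ≤ discountedUniform c m ω ω' :=
  le_ciSup (hm.bddAbove_range_discounted hc ω ω') t

theorem IsLscPseudometric.discountedUniform_mem_unitInterval (hm : IsLscPseudometric m)
    (hc : c ∈ I) (ω ω' : Trajectory E) : discountedUniform c m ω ω' ∈ I :=
  ⟨Real.iSup_nonneg fun t => (hm.discounted_mem_unitInterval hc t _ _).1,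
    ciSup_le fun t => (hm.discounted_mem_unitInterval hc t _ _).2⟩

theorem IsLscPseudometric.lowerSemicontinuous_discountedUniform (hm : IsLscPseudometric m)
    (hc : c ∈ I) :
    LowerSemicontinuous fun p : Trajectory E × Trajectory E => discountedUniform c m p.1 p.2 := by
  refine lowerSemicontinuous_ciSup (fun p => hm.bddAbove_range_discounted hc p.1 p.2) fun t => ?_
  have hcoord : Continuous fun p : Trajectory E × Trajectory E => (p.1 t, p.2 t) := by fun_prop
  exact (continuous_const_mul (c ^ (t : ℝ))).comp_lowerSemicontinuous (hm.lsc.comp hcoord)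
    (monotone_mul_left_of_nonneg (rpow_mem_unitInterval hc t).1)

variable [MeasurableSpace E] [SecondCountableTopology (Trajectory E)]
  [BorelSpace (Trajectory E)]

theorem IsLscPseudometric.le_integral_discountedUniform (hm : IsLscPseudometric m) (hc : c ∈ I)
    {μ ν : Measure (Trajectory E)} {x y : E} (hμ : ∀ᵐ ω ∂μ, ω 0 = x) (hν : ∀ᵐ ω ∂ν, ω 0 = y)
    {γ : Measure (Trajectory E × Trajectory E)} (hγ : γ ∈ couplings μ ν) :
    m x y ≤ ∫ p, discountedUniform c m p.1 p.2 ∂γ := by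
  obtain ⟨_, rfl, rfl⟩ := hγ
  calc m x y = ∫ _, m x y ∂γ := by simp
    _ ≤ ∫ p, discountedUniform c m p.1 p.2 ∂γ := by
      refine integral_mono_ae (integrable_const _) (integrable_of_mem_unitInterval
        (hm.lowerSemicontinuous_discountedUniform hc).measurable
        fun p => hm.discountedUniform_mem_unitInterval hc p.1 p.2) ?_
      filter_upwards [ae_of_ae_map measurable_fst.aemeasurable hμ,
        ae_of_ae_map measurable_snd.aemeasurable hν] with p hp hp'
      simpa [hp, hp'] using hm.le_discountedUniform hc p.1 p.2 0

end DiscountedUniform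

section BehaviouralDist

/-- The pseudometric `sup_{f ∈ 𝓕} |f(x) - f(y)|` induced by a set `𝓕` of observables. -/
noncomputable def behaviouralDist {E : Type*} (𝓕 : Set (E → ℝ)) (x y : E) : ℝ :=
  ⨆ f : 𝓕, |f.1 x - f.1 y|

variable {E : Type*} {𝓕 : Set (E → ℝ)} {f : E → ℝ}

theorem abs_sub_le_one_of_mem_unitInterval (hf01 : ∀ x, f x ∈ I) (x y : E) : |f x - f y| ≤ 1 :=
  Real.dist_le_of_mem_Icc_01 (hf01 x) (hf01 y)

theorem bddAbove_range_abs_sub (h01 : ∀ f ∈ 𝓕, ∀ x, f x ∈ I) (x y : E) :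
    BddAbove (range fun f : 𝓕 => |f.1 x - f.1 y|) :=
  ⟨1, forall_mem_range.2 fun f => abs_sub_le_one_of_mem_unitInterval (h01 f f.2) x y⟩

theorem abs_sub_le_behaviouralDist (h01 : ∀ f ∈ 𝓕, ∀ x, f x ∈ I) (hf : f ∈ 𝓕) (x y : E) :
    |f x - f y| ≤ behaviouralDist 𝓕 x y :=
  le_ciSup (bddAbove_range_abs_sub h01 x y) ⟨f, hf⟩

variable [TopologicalSpace E]

theorem isLscPseudometric_behaviouralDist (hcont : ∀ f ∈ 𝓕, Continuous f)
    (h01 : ∀ f ∈ 𝓕, ∀ x, f x ∈ I) : IsLscPseudometric (behaviouralDist 𝓕) where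
  nonneg x y := Real.iSup_nonneg fun _ => abs_nonneg _
  le_one x y := Real.iSup_le
    (fun f => abs_sub_le_one_of_mem_unitInterval (h01 f f.2) x y) zero_le_one
  self x := by simp [behaviouralDist]
  symm x y := by simp only [behaviouralDist, abs_sub_comm]
  triangle x y z := Real.iSup_le
    (fun f => (abs_sub_le _ (f.1 y) _).trans (add_le_add
      (abs_sub_le_behaviouralDist h01 f.2 x y) (abs_sub_le_behaviouralDist h01 f.2 y z)))
    (add_nonneg (Real.iSup_nonneg fun _ => abs_nonneg _) (Real.iSup_nonneg fun _ => abs_nonneg _))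
  lsc := lowerSemicontinuous_ciSup (fun p => bddAbove_range_abs_sub h01 p.1 p.2) fun f =>
    (((hcont f f.2).comp continuous_fst).sub
      ((hcont f f.2).comp continuous_snd)).abs.lowerSemicontinuous

theorem denseRange_nnratCast : DenseRange ((↑) : ℚ≥0 → ℝ≥0) := by
  refine dense_of_exists_between fun {a b} hab => ?_
  obtain ⟨q, hq, haq, hqb⟩ := (NNReal.lt_iff_exists_rat_btwn a b).1 hab
  lift q to ℚ≥0 using hq
  have hcast : Real.toNNReal ((q : ℚ) : ℝ) = q := by
    ext
    rw [Real.coe_toNNReal _ (by exact_mod_cast q.2)]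
    rfl
  rw [hcast] at haq hqb
  exact ⟨_, mem_range_self q, haq, hqb⟩

/-- The trajectory observable `cᵗ · (f ∘ ev_t)`. -/
noncomputable def discountedEval (c : ℝ) (f : E → ℝ) (t : ℚ≥0) (ω : Trajectory E) : ℝ :=
  c ^ (t : ℝ) * f (ω t)

theorem continuous_discountedEval (c : ℝ) (hf : Continuous f) (t : ℚ≥0) :
    Continuous (discountedEval c f t) :=
  continuous_const.mul (hf.comp (continuous_eval_const _))

theorem abs_discountedEval_sub {c : ℝ} (hc : 0 < c) (f : E → ℝ) (t : ℚ≥0) (ω ω' : Trajectory E) :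
    |discountedEval c f t ω - discountedEval c f t ω'| = c ^ (t : ℝ) * |f (ω t) - f (ω' t)| := by
  rw [discountedEval, discountedEval, ← mul_sub, abs_mul, abs_of_pos (Real.rpow_pos_of_pos hc _)]

theorem discountedUniform_behaviouralDist_eq_iSup {c : ℝ} (hc₀ : 0 < c) (hc₁ : c ≤ 1)
    [Nonempty 𝓕] (hcont : ∀ f ∈ 𝓕, Continuous f) (h01 : ∀ f ∈ 𝓕, ∀ x, f x ∈ I)
    (ω ω' : Trajectory E) :
    discountedUniform c (behaviouralDist 𝓕) ω ω' =
      ⨆ i : 𝓕 × ℚ≥0, |discountedEval c i.1 i.2 ω - discountedEval c i.1 i.2 ω'| := by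
  have hle (i : 𝓕 × ℚ≥0) : |discountedEval c i.1 i.2 ω - discountedEval c i.1 i.2 ω'| ≤
      discountedUniform c (behaviouralDist 𝓕) ω ω' := by
    rw [abs_discountedEval_sub hc₀]
    exact (mul_le_mul_of_nonneg_left (abs_sub_le_behaviouralDist h01 i.1.2 _ _)
      (Real.rpow_nonneg hc₀.le _)).trans ((isLscPseudometric_behaviouralDist hcont
        h01).le_discountedUniform ⟨hc₀.le, hc₁⟩ ω ω' (i.2 : ℝ≥0))
  refine le_antisymm (ciSup_le fun t => ?_) (ciSup_le hle)
  rw [behaviouralDist, Real.mul_iSup_of_nonneg (Real.rpow_nonneg hc₀.le _)]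
  refine ciSup_le fun f => ?_
  have hf := hcont f f.2
  have hdiscounted : Continuous fun s : ℝ≥0 => c ^ (s : ℝ) * |f.1 (ω s) - f.1 (ω' s)| :=
    (continuous_const.rpow NNReal.continuous_coe fun _ => .inl hc₀.ne').mul
      ((hf.comp ω.continuous).sub (hf.comp ω'.continuous)).abs
  refine denseRange_nnratCast.induction_on t (isClosed_le hdiscounted continuous_const) fun q => ?_
  exact (abs_discountedEval_sub hc₀ f.1 q ω ω').symm.trans_le
    (le_ciSup (f := fun i : 𝓕 × ℚ≥0 =>
      |discountedEval c i.1 i.2 ω - discountedEval c i.1 i.2 ω'|)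
      ⟨_, forall_mem_range.2 hle⟩ (f, q))

end BehaviouralDist

section TrajectoryLogic

variable {E : Type*} [TopologicalSpace E] [MeasurableSpace E]

/-- An abstract behavioural logic for a family of laws on trajectory space: `𝓕` plays the role of
the interpretations of state expressions and `𝓖` that of the interpretations of trajectory
expressions, with discount factor `c`. -/
structure IsTrajectoryLogic (law : E → ProbabilityMeasure (Trajectory E)) (c : ℝ)
    (𝓕 : Set (E → ℝ)) (𝓖 : Set (Trajectory E → ℝ)) : Prop where
  nonempty : 𝓕.Nonempty
  countable : 𝓕.Countable
  continuous : ∀ f ∈ 𝓕, Continuous f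
  mem_unitInterval : ∀ f ∈ 𝓕, ∀ x, f x ∈ I
  oneSub_mem : ∀ f ∈ 𝓕, (fun x => 1 - f x) ∈ 𝓕
  integral_mem : ∀ g ∈ 𝓖, (fun x => ∫ ω, g ω ∂(law x : Measure (Trajectory E))) ∈ 𝓕
  discountedEval_mem : ∀ f ∈ 𝓕, ∀ t : ℚ≥0, discountedEval c f t ∈ 𝓖
  measurable_trajectory : ∀ g ∈ 𝓖, Measurable g
  mem_unitInterval_trajectory : ∀ g ∈ 𝓖, ∀ ω, g ω ∈ I
  isClosedUnderConnectives : IsClosedUnderConnectives 𝓖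

variable {law : E → ProbabilityMeasure (Trajectory E)} {c : ℝ} {𝓕 : Set (E → ℝ)}
  {𝓖 : Set (Trajectory E → ℝ)}

theorem IsTrajectoryLogic.exists_coupling_integral_le [PolishSpace E] [BorelSpace (Trajectory E)]
    (h : IsTrajectoryLogic law c 𝓕 𝓖) (hc₀ : 0 < c) (hc₁ : c ≤ 1) (x y : E) :
    ∃ γ ∈ couplings (law x : Measure (Trajectory E)) (law y : Measure (Trajectory E)),
      ∫ p, discountedUniform c (behaviouralDist 𝓕) p.1 p.2 ∂γ ≤ behaviouralDist 𝓕 x y := by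
  have := h.nonempty.to_subtype
  have := h.countable.to_subtype
  simp only [discountedUniform_behaviouralDist_eq_iSup hc₀ hc₁ h.continuous h.mem_unitInterval]
  refine h.isClosedUnderConnectives.exists_coupling_integral_iSup_abs_sub_le
    (g := fun (i : 𝓕 × ℚ≥0) => discountedEval c i.1 i.2)
    h.mem_unitInterval_trajectory h.measurable_trajectory (fun g hg => ?_)
    (fun i => h.discountedEval_mem i.1 i.1.2 i.2)
    (fun i => continuous_discountedEval c (h.continuous i.1 i.1.2) i.2)
    fun i => ⟨c ^ (i.2 : ℝ), ?_⟩
  · exact (le_abs_self _).trans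
      (abs_sub_le_behaviouralDist h.mem_unitInterval (h.integral_mem g hg) x y)
  · convert h.discountedEval_mem _ (h.oneSub_mem i.1 i.1.2) i.2 using 2 with ω
    simp only [discountedEval, mul_sub, mul_one]

end TrajectoryLogic

/-! ### The interpretations form a trajectory logic -/

section Logic

mutual

/-- A Gödel numbering of state expressions, which witnesses that the logic is countable. -/
def StateExpr.code : StateExpr → ℕ
  | .const q => Nat.pair 0 (Encodable.encode q)
  | .obs => Nat.pair 1 0
  | .oneSub f => Nat.pair 2 f.code
  | .integral g => Nat.pair 3 g.code

/-- A Gödel numbering of trajectory expressions, which witnesses that the logic is countable. -/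
def TrajExpr.code : TrajExpr → ℕ
  | .ev f t => Nat.pair 0 (Nat.pair f.code (Encodable.encode t))
  | .min g₁ g₂ => Nat.pair 1 (Nat.pair g₁.code g₂.code)
  | .max g₁ g₂ => Nat.pair 2 (Nat.pair g₁.code g₂.code)
  | .ominus g q => Nat.pair 3 (Nat.pair g.code (Encodable.encode q))
  | .oplus g q => Nat.pair 4 (Nat.pair g.code (Encodable.encode q))

end

mutual

theorem StateExpr.eq_of_code_eq : ∀ f f' : StateExpr, f.code = f'.code → f = f'
  | .const _, f' | .obs, f' => by
    cases f' <;> grind [StateExpr.code, Nat.pair_eq_pair, Encodable.encode_inj]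
  | .oneSub f, f' => by
    have ih := f.eq_of_code_eq
    cases f' <;> grind [StateExpr.code, Nat.pair_eq_pair]
  | .integral g, f' => by
    have ih := g.eq_of_code_eq
    cases f' <;> grind [StateExpr.code, Nat.pair_eq_pair]

theorem TrajExpr.eq_of_code_eq : ∀ g g' : TrajExpr, g.code = g'.code → g = g'
  | .ev f _, g' => by
    have ih := f.eq_of_code_eq
    cases g' <;> grind [TrajExpr.code, Nat.pair_eq_pair, Encodable.encode_inj]
  | .min g₁ g₂, g' | .max g₁ g₂, g' => by
    have ih₁ := g₁.eq_of_code_eq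
    have ih₂ := g₂.eq_of_code_eq
    cases g' <;> grind [TrajExpr.code, Nat.pair_eq_pair]
  | .ominus g _, g' | .oplus g _, g' => by
    have ih := g.eq_of_code_eq
    cases g' <;> grind [TrajExpr.code, Nat.pair_eq_pair, Encodable.encode_inj]

end

instance countable_stateExpr : Countable StateExpr :=
  Function.Injective.countable (f := StateExpr.code) StateExpr.eq_of_code_eq

theorem integral_mem_unitInterval {Ω : Type*} [MeasurableSpace Ω] (μ : Measure Ω)
    [IsProbabilityMeasure μ] {g : Ω → ℝ} (hg01 : ∀ ω, g ω ∈ I) : ∫ ω, g ω ∂μ ∈ I := by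
  have hnorm (ω : Ω) : ‖g ω‖ ≤ 1 := (Real.norm_of_nonneg (hg01 ω).1).trans_le (hg01 ω).2
  refine ⟨integral_nonneg fun ω => (hg01 ω).1, (Real.le_norm_self _).trans ?_⟩
  simpa using norm_integral_le_of_norm_le_const (μ := μ) (ae_of_all _ hnorm)

theorem ratCast_mem_unitInterval (q : Set.Icc (0 : ℚ) 1) : ((q : ℚ) : ℝ) ∈ I :=
  ⟨by exact_mod_cast q.2.1, by exact_mod_cast q.2.2⟩

variable {E : Type*} [TopologicalSpace E] [LocallyCompactSpace E] [T2Space E]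
  [SecondCountableTopology E] [MeasurableSpace E] [BorelSpace E] (X : Diffusion E) (obs : C(E, I))
  {c : ℝ}

mutual

theorem StateExpr.eval_mem_unitInterval (hc : c ∈ I) : ∀ (f : StateExpr) (x : E),
    f.eval X obs c x ∈ I
  | .const q, _ => ratCast_mem_unitInterval q
  | .obs, x => (obs x).2
  | .oneSub f, x => Icc.mem_iff_one_sub_mem.1 (f.eval_mem_unitInterval hc x)
  | .integral g, _ => integral_mem_unitInterval _ (g.eval_mem_unitInterval hc)

theorem TrajExpr.eval_mem_unitInterval (hc : c ∈ I) : ∀ (g : TrajExpr) (ω : Trajectory E),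
    g.eval X obs c ω ∈ I
  | .ev f t, _ => unitInterval.mul_mem (rpow_mem_unitInterval hc (t : ℝ≥0))
      (f.eval_mem_unitInterval hc _)
  | .min g₁ g₂, ω => ⟨le_min (g₁.eval_mem_unitInterval hc ω).1 (g₂.eval_mem_unitInterval hc ω).1,
      min_le_of_left_le (g₁.eval_mem_unitInterval hc ω).2⟩
  | .max g₁ g₂, ω => ⟨le_max_of_le_left (g₁.eval_mem_unitInterval hc ω).1,
      max_le (g₁.eval_mem_unitInterval hc ω).2 (g₂.eval_mem_unitInterval hc ω).2⟩
  | .ominus g q, ω => ⟨le_max_left _ _, max_le zero_le_one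
      ((sub_le_self _ (ratCast_mem_unitInterval q).1).trans (g.eval_mem_unitInterval hc ω).2)⟩
  | .oplus g q, ω => ⟨le_min zero_le_one
      (add_nonneg (g.eval_mem_unitInterval hc ω).1 (ratCast_mem_unitInterval q).1), min_le_left _ _⟩

end

mutual

theorem StateExpr.continuous_eval (hc : c ∈ I) : ∀ f : StateExpr, Continuous (f.eval X obs c)
  | .const _ => continuous_const
  | .obs => continuous_subtype_val.comp obs.continuous
  | .oneSub f => continuous_const.sub (f.continuous_eval hc)
  | .integral g => (continuous_integral_probabilityMeasure (g.continuous_eval hc)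
      (g.eval_mem_unitInterval X obs hc)).comp X.law_continuous

theorem TrajExpr.continuous_eval (hc : c ∈ I) : ∀ g : TrajExpr, Continuous (g.eval X obs c)
  | .ev f t => continuous_discountedEval c (f.continuous_eval hc) t
  | .min g₁ g₂ => (g₁.continuous_eval hc).min (g₂.continuous_eval hc)
  | .max g₁ g₂ => (g₁.continuous_eval hc).max (g₂.continuous_eval hc)
  | .ominus g _ => continuous_const.max ((g.continuous_eval hc).sub continuous_const)
  | .oplus g _ => continuous_const.min ((g.continuous_eval hc).add continuous_const)

end

theorem logicPseudometric_eq_behaviouralDist (c : ℝ) :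
    logicPseudometric X obs c = behaviouralDist (range (StateExpr.eval X obs c)) :=
  funext₂ fun x y => (iSup_range' (fun f : E → ℝ => |f x - f y|) (StateExpr.eval X obs c)).symm

theorem Diffusion.ae_eval_zero (x : E) :
    ∀ᵐ ω ∂(X.law x : Measure (Trajectory E)), ω 0 = x := by
  have hx : MeasurableSet {ω : Trajectory E | ω 0 = x} :=
    measurable_coord 0 (measurableSet_singleton x)
  refine (mem_ae_iff_prob_eq_one hx).2 ?_
  simpa [cylinderMass] using X.law_cylinder x {x} [] (measurableSet_singleton x) (by simp) (by simp)

theorem isClosedUnderConnectives_range_eval (c : ℝ) :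
    IsClosedUnderConnectives (range (TrajExpr.eval X obs c)) where
  inf := forall_mem_range.2 fun g₁ => forall_mem_range.2 fun g₂ => ⟨.min g₁ g₂, rfl⟩
  sup := forall_mem_range.2 fun g₁ => forall_mem_range.2 fun g₂ => ⟨.max g₁ g₂, rfl⟩
  ominus := forall_mem_range.2 fun g q => ⟨.ominus g q, rfl⟩
  oplus := forall_mem_range.2 fun g q => ⟨.oplus g q, rfl⟩

theorem isTrajectoryLogic_range_eval (hc : c ∈ I) :
    IsTrajectoryLogic X.law c (range (StateExpr.eval X obs c)) (range (TrajExpr.eval X obs c)) where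
  nonempty := ⟨_, .obs, rfl⟩
  countable := countable_range _
  continuous := forall_mem_range.2 fun f => f.continuous_eval X obs hc
  mem_unitInterval := forall_mem_range.2 fun f => f.eval_mem_unitInterval X obs hc
  oneSub_mem := forall_mem_range.2 fun f => ⟨.oneSub f, rfl⟩
  integral_mem := forall_mem_range.2 fun g => ⟨.integral g, rfl⟩
  discountedEval_mem := forall_mem_range.2 fun f t => ⟨.ev f t, rfl⟩
  measurable_trajectory := forall_mem_range.2 fun g => (g.continuous_eval X obs hc).measurable
  mem_unitInterval_trajectory := forall_mem_range.2 fun g => g.eval_mem_unitInterval X obs hc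
  isClosedUnderConnectives := isClosedUnderConnectives_range_eval X obs c

end Logic

theorem mainTheorem3_general {E : Type*} [TopologicalSpace E] [PolishSpace E] [MeasurableSpace E]
    [BorelSpace (Trajectory E)] {law : E → ProbabilityMeasure (Trajectory E)}
    (hlaw : ∀ x, ∀ᵐ ω ∂(law x : Measure (Trajectory E)), ω 0 = x) {c : ℝ} (hc₀ : 0 < c)
    (hc₁ : c ≤ 1) {𝓕 : Set (E → ℝ)} {𝓖 : Set (Trajectory E → ℝ)}
    (h : IsTrajectoryLogic law c 𝓕 𝓖) :
    IsLscPseudometric (behaviouralDist 𝓕) ∧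
    (fun x y => transportCost (discountedUniform c (behaviouralDist 𝓕))
      (law x : Measure (Trajectory E)) (law y)) = behaviouralDist 𝓕 ∧
    ∀ x y : E, ∃ γ ∈ couplings (law x : Measure (Trajectory E)) (law y : Measure (Trajectory E)),
      ∫ p, discountedUniform c (behaviouralDist 𝓕) p.1 p.2 ∂γ =
        transportCost (discountedUniform c (behaviouralDist 𝓕))
          (law x : Measure (Trajectory E)) (law y) := by
  have hm := isLscPseudometric_behaviouralDist h.continuous h.mem_unitInterval
  have hattained (x y : E) : ∃ γ ∈ couplings (law x : Measure (Trajectory E)) (law y),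
      ∫ p, discountedUniform c (behaviouralDist 𝓕) p.1 p.2 ∂γ = behaviouralDist 𝓕 x y := by
    obtain ⟨γ, hγ, hγle⟩ := h.exists_coupling_integral_le hc₀ hc₁ x y
    exact ⟨γ, hγ, hγle.antisymm
      (hm.le_integral_discountedUniform ⟨hc₀.le, hc₁⟩ (hlaw x) (hlaw y) hγ)⟩
  have hcost (x y : E) : transportCost (discountedUniform c (behaviouralDist 𝓕))
      (law x : Measure (Trajectory E)) (law y) = behaviouralDist 𝓕 x y :=
    IsLeast.csInf_eq ⟨hattained x y, forall_mem_image.2 fun _ =>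
      hm.le_integral_discountedUniform ⟨hc₀.le, hc₁⟩ (hlaw x) (hlaw y)⟩
  exact ⟨hm, funext₂ hcost, fun x y => hcost x y ▸ hattained x y⟩

end DiffusionLogic

theorem mainTheorem3 {E : Type*} [TopologicalSpace E] [LocallyCompactSpace E] [T2Space E]
    [SecondCountableTopology E] [MeasurableSpace E] [BorelSpace E]
    (X : DiffusionLogic.Diffusion E) (obs : C(E, unitInterval)) (c : ℝ) (hc₀ : 0 < c)
    (hc₁ : c < 1) :
    DiffusionLogic.IsLscPseudometric (DiffusionLogic.logicPseudometric X obs c) ∧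
    X.functional c (DiffusionLogic.logicPseudometric X obs c) =
      DiffusionLogic.logicPseudometric X obs c ∧
    ∀ x y : E, ∃ γ ∈ DiffusionLogic.couplings (X.law x : Measure (DiffusionLogic.Trajectory E))
        (X.law y : Measure (DiffusionLogic.Trajectory E)),
      ∫ p, DiffusionLogic.discountedUniform c (DiffusionLogic.logicPseudometric X obs c)
        p.1 p.2 ∂γ = X.functional c (DiffusionLogic.logicPseudometric X obs c) x y := by
  have := DiffusionLogic.polishSpace_of_locallyCompactSpace E
  rw [DiffusionLogic.logicPseudometric_eq_behaviouralDist]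
  exact DiffusionLogic.mainTheorem3_general X.ae_eval_zero hc₀ hc₁.le
    (DiffusionLogic.isTrajectoryLogic_range_eval X obs ⟨hc₀.le, hc₁.le⟩)
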